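/- Let $d\ge 0$, $M\ge 1$, $N\ge 0$ be integers, $J\in\mathbb R$ and $g>0$. Consider the periodic $d$-dimensional cubic lattice with site set $\Lambda=(\mathbb Z/M\mathbb Z)^d$, whose links are the pairs $\langle i,j\rangle=(i,\,i+e_\mu)$ with $i\in\Lambda$ and $\mu\in\{1,\dots,d\}$. Let $a_i,a_i^\dagger$ ($i\in\Lambda$) be the bosonic annihilation and creation operators on the Fock space over $\Lambda$, let $|\mathrm{vac}\rangle$ be the vacuum, and let $\mathcal H_N$ be the (finite-dimensional) $N$-particle Hilbert space. On $\mathcal H_N$ consider the Hamiltonian of non-interacting bosons and the quasi-local jump operators $$H_0=-J\sum_{\langle i,j\rangle}\bigl(a_i^\dagger a_j+a_j^\dagger a_i\bigr),\qquad c_{ij}=(a_i^\dagger+a_j^\dagger)(a_i-a_j)\quad\text{for each link }\langle i,j\rangle,$$ and the master equation $\dot\rho=\mathcal L(\rho)$ with $$\mathcal L(\rho)=-i[H_0,\rho]+g\sum_{\langle i,j\rangle}\bigl(2c_{ij}\rho c_{ij}^\dagger-c_{ij}^\dagger c_{ij}\rho-\rho c_{ij}^\dagger c_{ij}\bigr).$$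 Let $|\mathrm{BEC}\rangle=\frac{1}{\sqrt{N!}}\,(a_{q=0}^{\dagger})^{N}|\mathrm{vac}\rangle$ with $a_{q=0}^\dagger=M^{-d/2}\sum_{j\in\Lambda}a_j^\dagger$. A dark state is a nonzero vector $\psi\in\mathcal H_N$ with $c_{ij}\psi=0$ for all links that is an eigenvector of $H_0$. Then: 1. a vector $\psi\in\mathcal H_N$ satisfies $c_{ij}\psi=0$ for all links if and only if $\psi\in\mathbb C\,|\mathrm{BEC}\rangle$; 2. the dark states are exactly the nonzero multiples of $|\mathrm{BEC}\rangle$, i.e. $|\mathrm{BEC}\rangle$ is the unique dark state up to a scalar factor; 3. $|\mathrm{BEC}\rangle\langle\mathrm{BEC}|$ is the unique stationary state: a density matrix $\rho$ (pure or mixed) on $\mathcal H_N$ satisfies $\mathcal L(\rho)=0$ if and only if $\rho=|\mathrm{BEC}\rangle\langle\mathrm{BEC}|$. -/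

import Mathlib

open scoped BigOperators Matrix ComplexOrder

noncomputable section

namespace DrivenBEC

/-! Bosonic Fock space over a finite set of sites -/

/-- The algebraic Fock space of bosons on the sites `ι`: finite linear combinations of the
occupation number states `|n⟩`, `n : ι → ℕ`, which are taken to be orthonormal. -/
abbrev Fock (ι : Type) : Type := (ι → ℕ) →₀ ℂ

/-- The vacuum state `|0⟩`. -/
def vacuum (ι : Type) : Fock ι := Finsupp.single 0 1

/-- `a_i |n⟩ = √(n_i) |n - e_i⟩` (which is `0` if `n_i = 0`). -/
def annihilate {ι : Type} [DecidableEq ι] (i : ι) : Fock ι →ₗ[ℂ] Fock ι :=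
  Finsupp.lsum ℂ fun n => ((Real.sqrt (n i) : ℝ) : ℂ) • Finsupp.lsingle (n - Pi.single i 1)

/-- `a_i† |n⟩ = √(n_i + 1) |n + e_i⟩`. -/
def create {ι : Type} [DecidableEq ι] (i : ι) : Fock ι →ₗ[ℂ] Fock ι :=
  Finsupp.lsum ℂ fun n => ((Real.sqrt (n i + 1) : ℝ) : ℂ) • Finsupp.lsingle (n + Pi.single i 1)

/-- The occupation numbers with exactly `N` particles; they label the orthonormal occupation
number basis of the `N`-particle Hilbert space. -/
abbrev Occ (ι : Type) [Fintype ι] (N : ℕ) : Type := {n : ι → ℕ // ∑ i, n i = N}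

instance instFintypeOcc (ι : Type) [Fintype ι] [DecidableEq ι] (N : ℕ) : Fintype (Occ ι N) :=
  Fintype.subtype (Finset.piAntidiag Finset.univ N) (by intro n; simp)

/-- The `N`-particle sector as a subspace of Fock space. -/
def sector (ι : Type) [Fintype ι] (N : ℕ) : Submodule ℂ (Fock ι) :=
  Finsupp.supported ℂ ℂ {n | ∑ i, n i = N}

/-- Coordinates, in the occupation number basis, of a vector of the `N`-particle sector. -/
def sectorVec {ι : Type} [Fintype ι] (N : ℕ) (ψ : Fock ι) : Occ ι N → ℂ := fun n => ψ n.1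

/-- Matrix `⟨m| A |n⟩`, in the occupation number basis, of the restriction to the `N`-particle
sector of an operator `A` that conserves the particle number. -/
def sectorMatrix {ι : Type} [Fintype ι] (N : ℕ) (A : Fock ι →ₗ[ℂ] Fock ι) :
    Matrix (Occ ι N) (Occ ι N) ℂ :=
  Matrix.of fun m n => A (Finsupp.single n.1 1) m.1

/-! Master equations on a finite-dimensional Hilbert space with a chosen orthonormal basis -/

/-- The generator
`ρ ↦ -i [H, ρ] + ∑ l, g_l (2 c_l ρ c_l† - c_l† c_l ρ - ρ c_l† c_l)` of the master equation. -/
def liouvillian {n β : Type} [Fintype n] [Fintype β] (H : Matrix n n ℂ) (g : β → ℝ)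
    (c : β → Matrix n n ℂ) (ρ : Matrix n n ℂ) : Matrix n n ℂ :=
  -Complex.I • (H * ρ - ρ * H) +
    ∑ l, (g l : ℂ) • ((2 : ℂ) • (c l * ρ * (c l)ᴴ) - (c l)ᴴ * c l * ρ - ρ * ((c l)ᴴ * c l))

/-- A (pure or mixed) state: a density matrix. -/
def IsState {n : Type} [Fintype n] (ρ : Matrix n n ℂ) : Prop :=
  ρ.PosSemidef ∧ ρ.trace = 1

/-- A stationary state of the master equation. -/
def IsStationaryState {n β : Type} [Fintype n] [Fintype β] (H : Matrix n n ℂ) (g : β → ℝ)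
    (c : β → Matrix n n ℂ) (ρ : Matrix n n ℂ) : Prop :=
  IsState ρ ∧ liouvillian H g c ρ = 0

/-- A (pure) dark state: a nonzero vector annihilated by all jump operators which is an
eigenvector of the Hamiltonian. -/
def IsDarkState {n β : Type} [Fintype n] (H : Matrix n n ℂ) (c : β → Matrix n n ℂ)
    (ψ : n → ℂ) : Prop :=
  ψ ≠ 0 ∧ (∀ l, c l *ᵥ ψ = 0) ∧ ∃ E : ℂ, H *ᵥ ψ = E • ψ

/-- The projector `|ψ⟩⟨ψ|`. -/
def ketBra {n : Type} (ψ : n → ℂ) : Matrix n n ℂ := Matrix.vecMulVec ψ (star ψ)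

/-! The periodic lattice with `M ^ d` sites -/

/-- Sites of the periodic `d`-dimensional cubic lattice with `M` sites in each direction. -/
abbrev Site (d M : ℕ) : Type := Fin d → ZMod M

/-- Links `⟨i, j⟩`: the link `(i, μ)` joins the site `i` to the site `j = i + e_μ`. -/
abbrev Link (d M : ℕ) : Type := Site d M × Fin d

/-- The end point `j = i + e_μ` of the link `(i, μ)`. -/
def Link.target {d M : ℕ} (l : Link d M) : Site d M := l.1 + Pi.single l.2 1

/-- The jump operator `c_{ij} = (a_i† + a_j†) (a_i - a_j)` of a link `⟨i, j⟩`. -/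
def jump {d M : ℕ} (l : Link d M) : Fock (Site d M) →ₗ[ℂ] Fock (Site d M) :=
  (create l.1 + create (Link.target l)) ∘ₗ (annihilate l.1 - annihilate (Link.target l))

/-- The kinetic Hamiltonian `H₀ = -J ∑_{⟨i,j⟩} (a_i† a_j + a_j† a_i)`. -/
def hopping {d M : ℕ} [NeZero M] (J : ℝ) : Fock (Site d M) →ₗ[ℂ] Fock (Site d M) :=
  -(J : ℂ) • ∑ l : Link d M,
    (create l.1 ∘ₗ annihilate (Link.target l) + create (Link.target l) ∘ₗ annihilate l.1)

/-- The creation operator `a_q† = M^{-d/2} ∑_j e^{-i q·j} a_j†` of the quasimomentum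
`q = 2 π k / M`. -/
def createMomentum {d M : ℕ} [NeZero M] (k : Site d M) :
    Fock (Site d M) →ₗ[ℂ] Fock (Site d M) :=
  ((Real.sqrt ((M : ℝ) ^ d) : ℝ) : ℂ)⁻¹ •
    ∑ j : Site d M, ZMod.stdAddChar (-∑ μ, k μ * j μ) • create j

/-- The condensate `|BEC⟩ = (a_{q=0}†)^N / √(N!) |vac⟩`. -/
def bec (d M N : ℕ) [NeZero M] : Fock (Site d M) :=
  ((Real.sqrt (N.factorial : ℝ) : ℝ) : ℂ)⁻¹ •
    (createMomentum (0 : Site d M) ^ N) (vacuum (Site d M))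

/-- The jump operators on the `N`-particle Hilbert space. -/
def jumpN (d M N : ℕ) [NeZero M] (l : Link d M) :
    Matrix (Occ (Site d M) N) (Occ (Site d M) N) ℂ :=
  sectorMatrix N (jump l)

/-- The Hamiltonian `H₀` on the `N`-particle Hilbert space. -/
def hoppingN (d M N : ℕ) [NeZero M] (J : ℝ) :
    Matrix (Occ (Site d M) N) (Occ (Site d M) N) ℂ :=
  sectorMatrix N (hopping J)

/-- The condensate as a vector of the `N`-particle Hilbert space. -/
def becN (d M N : ℕ) [NeZero M] : Occ (Site d M) N → ℂ := sectorVec N (bec d M N)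

/-! The operators above conserve the particle number and the condensate has `N` particles, so
that passing to the `N`-particle sector loses nothing. -/

theorem create_mem {ι : Type} [Fintype ι] [DecidableEq ι] (i : ι) {N : ℕ} {ψ : Fock ι}
    (h : ψ ∈ sector ι N) : create i ψ ∈ sector ι (N + 1) := by
  rw [create, Finsupp.lsum_apply]
  refine Submodule.sum_mem _ fun n hn => ?_
  refine Submodule.smul_mem _ _ (Finsupp.single_mem_supported _ _ ?_)
  have : ∑ i, n i = N := h hn
  simp [Finset.sum_add_distrib, this]

theorem create_annihilate_mem {ι : Type} [Fintype ι] [DecidableEq ι] (i j : ι) {N : ℕ}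
    {ψ : Fock ι} (h : ψ ∈ sector ι N) : create i (annihilate j ψ) ∈ sector ι N := by
  rw [annihilate, Finsupp.lsum_apply, Finsupp.sum, map_sum]
  refine Submodule.sum_mem _ fun n hn => ?_
  have hN : ∑ i, n i = N := h hn
  rw [LinearMap.smul_apply, map_smul]
  rcases Nat.eq_zero_or_pos (n j) with h0 | h0
  · simp [h0]
  · refine Submodule.smul_mem _ _ ?_
    have hs : ∑ i, (n - Pi.single j 1 : ι → ℕ) i + 1 = N := by
      have e : (n - Pi.single j 1 : ι → ℕ) + Pi.single j 1 = n := by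
        funext x
        by_cases hx : x = j
        · subst hx; simp; omega
        · simp [hx]
      have := congrArg (fun f : ι → ℕ => ∑ i, f i) e
      simpa [Finset.sum_add_distrib, hN] using this
    rw [← hs]
    exact create_mem i (Finsupp.single_mem_supported _ _ rfl)

theorem jump_mem {d M : ℕ} [NeZero M] (l : Link d M) {N : ℕ} {ψ : Fock (Site d M)}
    (h : ψ ∈ sector (Site d M) N) : jump l ψ ∈ sector (Site d M) N := by
  have e : jump l ψ =
      (create l.1 (annihilate l.1 ψ) - create l.1 (annihilate (Link.target l) ψ)) +
        (create (Link.target l) (annihilate l.1 ψ) -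
          create (Link.target l) (annihilate (Link.target l) ψ)) := by
    rw [jump, LinearMap.comp_apply, LinearMap.add_apply, LinearMap.sub_apply, map_sub, map_sub]
  rw [e]
  exact Submodule.add_mem _
    (Submodule.sub_mem _ (create_annihilate_mem _ _ h) (create_annihilate_mem _ _ h))
    (Submodule.sub_mem _ (create_annihilate_mem _ _ h) (create_annihilate_mem _ _ h))

theorem hopping_mem {d M : ℕ} [NeZero M] (J : ℝ) {N : ℕ} {ψ : Fock (Site d M)}
    (h : ψ ∈ sector (Site d M) N) : hopping J ψ ∈ sector (Site d M) N := by
  simp only [hopping, LinearMap.smul_apply, LinearMap.sum_apply, LinearMap.add_apply,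
    LinearMap.comp_apply]
  exact Submodule.smul_mem _ _ (Submodule.sum_mem _ fun l _ =>
    Submodule.add_mem _ (create_annihilate_mem _ _ h) (create_annihilate_mem _ _ h))

theorem bec_mem (d M N : ℕ) [NeZero M] : bec d M N ∈ sector (Site d M) N := by
  suffices H : (createMomentum (0 : Site d M) ^ N) (vacuum (Site d M)) ∈ sector (Site d M) N from
    Submodule.smul_mem _ _ H
  induction N with
  | zero =>
    have h0 : (0 : Site d M → ℕ) ∈ {n : Site d M → ℕ | ∑ i, n i = 0} := by simp
    rw [pow_zero, Module.End.one_apply]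
    exact Finsupp.single_mem_supported ℂ (1 : ℂ) h0
  | succ N ih =>
    rw [pow_succ', Module.End.mul_apply]
    simp only [createMomentum, LinearMap.smul_apply, LinearMap.sum_apply]
    exact Submodule.smul_mem _ _ (Submodule.sum_mem _ fun j _ =>
      Submodule.smul_mem _ _ (create_mem j ih))

/-- For operators that conserve the particle number, the matrices describe the action on the
`N`-particle sector. -/
theorem sectorMatrix_mulVec {ι : Type} [Fintype ι] [DecidableEq ι] (N : ℕ)
    (A : Fock ι →ₗ[ℂ] Fock ι) {ψ : Fock ι} (h : ψ ∈ sector ι N) :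
    sectorMatrix N A *ᵥ sectorVec N ψ = sectorVec N (A ψ) := by
  funext m
  have hψ : ψ = ∑ n : Occ ι N, ψ n.1 • Finsupp.single n.1 (1 : ℂ) := by
    ext k
    simp only [Finsupp.coe_finsetSum, Finset.sum_apply, Finsupp.smul_apply,
      Finsupp.single_apply, smul_eq_mul, mul_ite, mul_one, mul_zero]
    by_cases hk : ∑ i, k i = N
    · rw [Finset.sum_eq_single (⟨k, hk⟩ : Occ ι N)]
      · simp
      · intro b _ hb
        exact if_neg fun e => hb (Subtype.ext e)
      · intro hh; exact absurd (Finset.mem_univ _) hh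
    · rw [Finset.sum_eq_zero fun (b : Occ ι N) _ => if_neg fun e : b.1 = k => hk (e ▸ b.2)]
      by_contra h0
      exact hk (h (Finsupp.mem_support_iff.2 h0))
  have hA : A ψ = ∑ n : Occ ι N, ψ n.1 • A (Finsupp.single n.1 (1 : ℂ)) := by
    conv_lhs => rw [hψ]
    rw [map_sum]
    exact Finset.sum_congr rfl fun n _ => map_smul _ _ _
  simp only [Matrix.mulVec, dotProduct, sectorMatrix, sectorVec, Matrix.of_apply, hA,
    Finsupp.coe_finsetSum, Finset.sum_apply, Finsupp.smul_apply, smul_eq_mul]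
  exact Finset.sum_congr rfl fun n _ => mul_comm _ _

end DrivenBEC

end

open DrivenBEC

/-! In the Bargmann picture, `fockOfPoly` turns `create i` into multiplication by `X i` and
`annihilate i` into `pderiv i`. The condensate is then a multiple of s^N with s the sum of all
variables, and the adjoint jump operator of a link is (x_i - x_j)(∂_i + ∂_j).

Everything rests on a generation property, `becN_generates`: a subspace that contains the adjoint
jumps of the condensate and is stable under all adjoint jumps spans the whole sector together with
the condensate. By Leibniz, an adjoint jump trades a factor s for a link form, up to terms with
fewer traded factors (`pow_mul_mem_of_invariant`). Since the lattice is connected, s and the link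
forms span all linear forms, so their N-fold products span degree N.

The rest is linear algebra. For a vector killed by all jumps, the part orthogonal to the condensate
is orthogonal to everything generated, hence zero. For a stationary ρ, the expectation of the
Liouvillian in the condensate, or in a kernel vector v of ρ, reduces to a positively weighted sum of
terms ⟨c†v|ρ|c†v⟩ ≥ 0. All of them vanish, so the part of ker ρ orthogonal to the condensate
satisfies the generation hypotheses, and ρ is the condensate projector (`isStationaryState_iff`). -/

namespace DrivenBEC

open MvPolynomial

/-! Polynomials of linear forms -/

section Generation

variable {β : Type}

/-- If a derivation maps `Y` to constants, then it maps `Y ^ m`, after multiplication with an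
element of `Y`, to `Y ^ m`. -/
theorem mul_derivation_mem_pow {A : Type*} [CommRing A] [Algebra ℂ A] (δ : Derivation ℂ A A)
    (Y : Submodule ℂ A) (hY : ∀ y ∈ Y, δ y ∈ (1 : Submodule ℂ A)) (m : ℕ) {u q : A}
    (hu : u ∈ Y) (hq : q ∈ Y ^ m) : u * δ q ∈ Y ^ m := by
  induction m generalizing q with
  | zero =>
    rw [pow_zero, Submodule.mem_one] at hq
    obtain ⟨c, rfl⟩ := hq
    simp
  | succ m ih =>
    rw [pow_succ'] at hq
    induction hq using Submodule.mul_induction_on' with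
    | mem_mul_mem y hy q hq =>
      -- The factor y lost to differentiation is replaced by u, since δ y is a constant.
      have h1 : δ y * (u * q) ∈ Y ^ (m + 1) := by
        have := Submodule.mul_mem_mul (hY y hy) (Submodule.mul_mem_mul hu hq)
        rwa [one_mul, ← pow_succ'] at this
      have h2 : y * (u * δ q) ∈ Y ^ (m + 1) := by
        rw [pow_succ']
        exact Submodule.mul_mem_mul hy (ih hq)
      rw [Derivation.leibniz, smul_eq_mul, smul_eq_mul]
      have e : u * (y * δ q + q * δ y) = y * (u * δ q) + δ y * (u * q) := by ring
      rw [e]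
      exact Submodule.add_mem _ h2 h1
    | add x _ y _ hx hy =>
      rw [map_add, mul_add]
      exact Submodule.add_mem _ hx hy

/-- Suppose that `s` is a linear form on which the derivations `δ l` take the value `2`. A
subspace which contains `y_l δ_l (s ^ N)` and is invariant under all `y_l δ_l` contains
`s ^ k q` for all products `q` of `m ≥ 1` forms `y_l`, where `k + m = N`. -/
theorem pow_mul_mem_of_invariant {A : Type*} [CommRing A] [Algebra ℂ A]
    (δ : β → Derivation ℂ A A) (y : β → A) (s : A) (hs : ∀ l, δ l s = 2)
    (hy : ∀ l l', δ l (y l') ∈ (1 : Submodule ℂ A)) (N : ℕ) (W : Submodule ℂ A)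
    (h0 : ∀ l, y l * δ l (s ^ N) ∈ W) (hW : ∀ l, ∀ f ∈ W, y l * δ l f ∈ W)
    (m k : ℕ) (hmk : k + (m + 1) = N) {q : A}
    (hq : q ∈ Submodule.span ℂ (Set.range y) ^ (m + 1)) : s ^ k * q ∈ W := by
  set Y := Submodule.span ℂ (Set.range y) with hYdef
  have hY : ∀ l, ∀ u ∈ Y, δ l u ∈ (1 : Submodule ℂ A) := by
    intro l u hu
    have : Y ≤ (1 : Submodule ℂ A).comap (δ l : A →ₗ[ℂ] A) := by
      rw [hYdef, Submodule.span_le]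
      rintro _ ⟨l', rfl⟩
      exact hy l l'
    exact this hu
  have cancel : ∀ (k : ℕ) (f : A), ((k + 1 : ℕ) : A) * 2 * f ∈ W → f ∈ W := by
    intro k f hf
    have e : ((k + 1 : ℕ) : A) * 2 * f = (((k + 1 : ℕ) : ℂ) * 2) • f := by
      rw [Algebra.smul_def, map_mul, map_natCast, map_ofNat]
    rw [e] at hf
    refine (Submodule.smul_mem_iff _ ?_).1 hf
    exact mul_ne_zero (Nat.cast_ne_zero.2 (Nat.succ_ne_zero k)) two_ne_zero
  -- The exchange identity: the first term has one s traded for y l, while the second keeps both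
  -- degrees.
  have expand : ∀ (k : ℕ) (l : β) (q : A), y l * δ l (s ^ (k + 1) * q) =
      ((k + 1 : ℕ) : A) * 2 * (s ^ k * (y l * q)) + s ^ (k + 1) * (y l * δ l q) := by
    intro k l q
    rw [Derivation.leibniz, Derivation.leibniz_pow, hs]
    simp only [smul_eq_mul, nsmul_eq_mul, Nat.add_sub_cancel]
    ring
  have extend : ∀ (k m : ℕ), (∀ l, ∀ q ∈ Y ^ m, s ^ k * (y l * q) ∈ W) →
      ∀ q ∈ Y ^ (m + 1), s ^ k * q ∈ W := by
    intro k m H q hq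
    rw [pow_succ'] at hq
    induction hq using Submodule.mul_induction_on' with
    | mem_mul_mem u hu q hq =>
      have : Y ≤ W.comap (LinearMap.mulLeft ℂ (s ^ k) ∘ₗ LinearMap.mulRight ℂ q) := by
        rw [hYdef, Submodule.span_le]
        rintro _ ⟨l, rfl⟩
        exact H l q hq
      exact this hu
    | add a _ b _ ha hb =>
      rw [mul_add]
      exact Submodule.add_mem _ ha hb
  induction m generalizing k q with
  | zero =>
    refine extend k 0 (fun l q hq => ?_) q hq
    rw [pow_zero, Submodule.mem_one] at hq
    obtain ⟨c, rfl⟩ := hq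
    refine cancel k _ ?_
    have h := expand k l (algebraMap ℂ A c)
    rw [Derivation.map_algebraMap, mul_zero, mul_zero, add_zero] at h
    rw [← h, mul_comm (s ^ (k + 1)), ← Algebra.smul_def, Derivation.map_smul, mul_smul_comm]
    -- Here k + 1 = N. The start needs `h0` separately, since s ^ N itself is not assumed to lie in
    -- W.
    rw [zero_add] at hmk
    rw [hmk]
    exact Submodule.smul_mem _ _ (h0 l)
  | succ m ih =>
    refine extend k (m + 1) (fun l q hq => ?_) q hq
    have hk : k + 1 + (m + 1) = N := by omega
    refine cancel k _ ?_
    have h := expand k l q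
    rw [← sub_eq_iff_eq_add] at h
    rw [← h]
    -- Both terms come from the previous degree: s ^ (k + 1) * q lies in W, and y l * δ l q has the
    -- same degree in Y as q.
    exact Submodule.sub_mem _ (hW l _ (ih (k + 1) hk hq))
      (ih (k + 1) hk (mul_derivation_mem_pow (δ l) Y (hY l) _
        (Submodule.subset_span ⟨l, rfl⟩) hq))

/-- In the situation of `pow_mul_mem_of_invariant`, the subspace together with `s ^ N` contains
all products of `N` forms from the span of `s` and the `y_l`. -/
theorem pow_le_sup_of_invariant {A : Type*} [CommRing A] [Algebra ℂ A]
    (δ : β → Derivation ℂ A A) (y : β → A) (s : A) (hs : ∀ l, δ l s = 2)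
    (hy : ∀ l l', δ l (y l') ∈ (1 : Submodule ℂ A)) (N : ℕ) (W : Submodule ℂ A)
    (h0 : ∀ l, y l * δ l (s ^ N) ∈ W) (hW : ∀ l, ∀ f ∈ W, y l * δ l f ∈ W) :
    (Submodule.span ℂ {s} ⊔ Submodule.span ℂ (Set.range y)) ^ N ≤
      W ⊔ Submodule.span ℂ {s ^ N} := by
  set Y := Submodule.span ℂ (Set.range y) with hYdef
  set U := Submodule.span ℂ {s} ⊔ Y with hU
  -- Expand the product one factor at a time, with r factors still unexpanded; each one contributes
  -- an s or an element of Y.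
  have key : ∀ (r k m : ℕ), k + m + r = N → ∀ q ∈ Y ^ m, ∀ p ∈ U ^ r,
      s ^ k * q * p ∈ W ⊔ Submodule.span ℂ {s ^ N} := by
    intro r
    induction r with
    | zero =>
      intro k m hN q hq p hp
      rw [pow_zero, Submodule.mem_one] at hp
      obtain ⟨c, rfl⟩ := hp
      rw [mul_comm, ← Algebra.smul_def]
      refine Submodule.smul_mem _ _ ?_
      cases m with
      | zero =>
        rw [pow_zero, Submodule.mem_one] at hq
        obtain ⟨c, rfl⟩ := hq
        rw [mul_comm, ← Algebra.smul_def, show k = N by omega]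
        exact Submodule.smul_mem _ _
          (Submodule.mem_sup_right (Submodule.mem_span_singleton_self _))
      | succ m =>
        exact Submodule.mem_sup_left
          (pow_mul_mem_of_invariant δ y s hs hy N W h0 hW m k (by omega) hq)
    | succ r ih =>
      intro k m hN q hq p hp
      rw [pow_succ'] at hp
      induction hp using Submodule.mul_induction_on' with
      | mem_mul_mem u hu p hp =>
        obtain ⟨a, ha, b, hb, rfl⟩ := Submodule.mem_sup.1 hu
        obtain ⟨c, rfl⟩ := Submodule.mem_span_singleton.1 ha
        have e : s ^ k * q * ((c • s + b) * p) =
            c • (s ^ (k + 1) * q * p) + s ^ k * (q * b) * p := by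
          rw [Algebra.smul_def, Algebra.smul_def]; ring
        rw [e]
        refine Submodule.add_mem _ (Submodule.smul_mem _ _ (ih _ m (by omega) q hq p hp))
          (ih k (m + 1) (by omega) _ ?_ p hp)
        rw [pow_succ]
        exact Submodule.mul_mem_mul hq hb
      | add a _ b _ ha hb =>
        rw [mul_add]
        exact Submodule.add_mem _ ha hb
  intro p hp
  have := key N 0 0 (by omega) 1 (by rw [pow_zero]; exact Submodule.one_le.1 le_rfl) p hp
  simpa using this

end Generation

/-! The representation of the Fock space by polynomials -/

/-- The linear map from polynomials to Fock space with `x ^ n ↦ √(n!) |n⟩`, which turns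
multiplication by `x_i` into `a_i†` and `∂_i` into `a_i`. -/
noncomputable def fockOfPoly (ι : Type) [Fintype ι] : MvPolynomial ι ℂ →ₗ[ℂ] Fock ι :=
  (basisMonomials ι ℂ).constr ℂ fun n =>
    Finsupp.single (⇑n) ((Real.sqrt ((∏ i, (n i).factorial : ℕ) : ℝ) : ℝ) : ℂ)

theorem fockOfPoly_monomial {ι : Type} [Fintype ι] (n : ι →₀ ℕ) (c : ℂ) :
    fockOfPoly ι (monomial n c) =
      Finsupp.single (⇑n) (c * ((Real.sqrt ((∏ i, (n i).factorial : ℕ) : ℝ) : ℝ) : ℂ)) := by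
  have e : (monomial n c : MvPolynomial ι ℂ) = c • basisMonomials ι ℂ n := by
    rw [coe_basisMonomials, smul_monomial, smul_eq_mul, mul_one]
  rw [e, map_smul, fockOfPoly, Module.Basis.constr_basis, Finsupp.smul_single, smul_eq_mul]

theorem fockOfPoly_apply {ι : Type} [Fintype ι] (p : MvPolynomial ι ℂ) (n : ι →₀ ℕ) :
    fockOfPoly ι p n =
      coeff n p * ((Real.sqrt ((∏ i, (n i).factorial : ℕ) : ℝ) : ℝ) : ℂ) := by
  classical
  induction p using MvPolynomial.induction_on' with
  | monomial m c =>
    rw [fockOfPoly_monomial, coeff_monomial, Finsupp.single_apply]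
    by_cases h : m = n
    · simp [h]
    · rw [if_neg h, if_neg fun h' => h (DFunLike.coe_injective h'), zero_mul]
  | add p q hp hq => rw [map_add, Finsupp.add_apply, hp, hq, coeff_add, add_mul]

theorem create_single {ι : Type} [DecidableEq ι] (i : ι) (n : ι → ℕ) (c : ℂ) :
    create i (Finsupp.single n c) =
      Finsupp.single (n + Pi.single i 1) (((Real.sqrt (n i + 1) : ℝ) : ℂ) * c) := by
  simp [create]

theorem annihilate_single {ι : Type} [DecidableEq ι] (i : ι) (n : ι → ℕ) (c : ℂ) :
    annihilate i (Finsupp.single n c) =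
      Finsupp.single (n - Pi.single i 1) (((Real.sqrt (n i) : ℝ) : ℂ) * c) := by
  simp [annihilate]

theorem fockOfPoly_mem_sector {ι : Type} [Fintype ι] {N : ℕ} {p : MvPolynomial ι ℂ} (hp : p.IsHomogeneous N) :
    fockOfPoly ι p ∈ sector ι N := by
  rw [p.as_sum, map_sum]
  refine Submodule.sum_mem _ fun n hn => ?_
  rw [fockOfPoly_monomial]
  refine Finsupp.single_mem_supported _ _ ?_
  rw [mem_support_iff] at hn
  by_contra h
  refine hn (hp.coeff_eq_zero ?_)
  rwa [Finsupp.degree_eq_sum]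

section Bargmann

variable {ι : Type} [Fintype ι] [DecidableEq ι]

theorem prod_factorial_add_single (i : ι) (n : ι → ℕ) :
    ∏ j, ((n + Pi.single i 1 : ι → ℕ) j).factorial = (n i + 1) * ∏ j, (n j).factorial := by
  rw [← Finset.mul_prod_erase _ _ (Finset.mem_univ i),
    ← Finset.mul_prod_erase _ (fun j => (n j).factorial) (Finset.mem_univ i), ← mul_assoc]
  congr 1
  · simp [Nat.factorial_succ]
  · refine Finset.prod_congr rfl fun j hj => ?_
    simp [Finset.ne_of_mem_erase hj]

theorem sqrt_prod_factorial_add_single (i : ι) (n : ι → ℕ) :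
    Real.sqrt ((∏ j, ((n + Pi.single i 1 : ι → ℕ) j).factorial : ℕ) : ℝ) =
      Real.sqrt (n i + 1) * Real.sqrt ((∏ j, (n j).factorial : ℕ) : ℝ) := by
  rw [prod_factorial_add_single, Nat.cast_mul, Real.sqrt_mul (Nat.cast_nonneg _)]
  push_cast
  rfl

theorem create_fockOfPoly (i : ι) (p : MvPolynomial ι ℂ) :
    create i (fockOfPoly ι p) = fockOfPoly ι (X i * p) := by
  suffices H : create i ∘ₗ fockOfPoly ι = fockOfPoly ι ∘ₗ LinearMap.mulLeft ℂ (X i) from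
    LinearMap.congr_fun H p
  refine MvPolynomial.linearMap_ext fun n => LinearMap.ext_ring ?_
  have e : (X i * monomial n 1 : MvPolynomial ι ℂ) = monomial (n + Finsupp.single i 1) 1 := by
    rw [X, monomial_mul, mul_one, add_comm]
  simp only [LinearMap.comp_apply, LinearMap.mulLeft_apply, e, fockOfPoly_monomial,
    create_single, one_mul, Finsupp.coe_add, Finsupp.single_eq_pi_single]
  rw [sqrt_prod_factorial_add_single, Complex.ofReal_mul]

/-- The weights √(n!) are what makes this work: √(n_i + 1) from the operator and √(n_i + 1) from the
factorial combine to the exponent n_i + 1 produced by the derivative. -/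
theorem annihilate_fockOfPoly (i : ι) (p : MvPolynomial ι ℂ) :
    annihilate i (fockOfPoly ι p) = fockOfPoly ι (pderiv i p) := by
  suffices H : annihilate i ∘ₗ fockOfPoly ι =
      fockOfPoly ι ∘ₗ (pderiv i : Derivation ℂ _ (MvPolynomial ι ℂ)).toLinearMap from
    LinearMap.congr_fun H p
  refine MvPolynomial.linearMap_ext fun n => LinearMap.ext_ring ?_
  simp only [LinearMap.comp_apply, Derivation.coeFn_coe, pderiv_monomial, fockOfPoly_monomial,
    annihilate_single, one_mul]
  -- At n i = 0 the subtraction truncates, but both coefficients vanish.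
  rcases Nat.eq_zero_or_pos (n i) with h0 | h0
  · simp [h0]
  · obtain ⟨n, rfl⟩ : ∃ n' : ι →₀ ℕ, n = n' + Finsupp.single i 1 :=
      ⟨n - Finsupp.single i 1, (tsub_add_cancel_of_le (by simpa [Nat.one_le_iff_ne_zero] using h0.ne')).symm⟩
    rw [add_tsub_cancel_right, Finsupp.coe_add, Finsupp.single_eq_pi_single,
      add_tsub_cancel_right, sqrt_prod_factorial_add_single, ← Complex.ofReal_mul, ← mul_assoc]
    congr 1
    simp only [Pi.add_apply, Pi.single_eq_same, Nat.cast_add, Nat.cast_one]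
    rw [Real.mul_self_sqrt (by positivity)]
    push_cast
    rfl

/-- A subspace of the `N`-particle space containing the images of all homogeneous polynomials
of degree `N` is everything. -/
theorem eq_top_of_forall_isHomogeneous {N : ℕ} (W : Submodule ℂ (Occ ι N → ℂ))
    (hW : ∀ p : MvPolynomial ι ℂ, p.IsHomogeneous N → sectorVec N (fockOfPoly ι p) ∈ W) :
    W = ⊤ := by
  rw [eq_top_iff, ← (Pi.basisFun ℂ (Occ ι N)).span_eq, Submodule.span_le]
  rintro _ ⟨n, rfl⟩
  set k : ι →₀ ℕ := Finsupp.equivFunOnFinite.symm n.1 with hk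
  have hkn : (k : ι → ℕ) = n.1 := by simp [hk]
  set c : ℂ := ((Real.sqrt ((∏ i, (k i).factorial : ℕ) : ℝ) : ℝ) : ℂ) with hc
  have hc0 : c ≠ 0 := by
    rw [hc, Ne, Complex.ofReal_eq_zero, Real.sqrt_eq_zero (Nat.cast_nonneg _),
      Nat.cast_eq_zero, Finset.prod_eq_zero_iff]
    rintro ⟨i, -, hi⟩
    exact Nat.factorial_ne_zero _ hi
  have h := hW (monomial k c⁻¹) (isHomogeneous_monomial _ (by
    rw [Finsupp.degree_eq_sum, hkn]; exact n.2))
  rw [fockOfPoly_monomial, ← hc, inv_mul_cancel₀ hc0, hkn] at h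
  have e : Pi.basisFun ℂ (Occ ι N) n = sectorVec N (Finsupp.single n.1 1) := by
    funext m
    simp [sectorVec, Pi.single_apply, Finsupp.single_apply, Subtype.ext_iff, eq_comm]
  rw [SetLike.mem_coe, e]
  exact h

end Bargmann

/-! Stationary states of master equations with a unique dark state -/

section Stationary

variable {n β : Type} [Fintype n]

/-- The orthogonal complement of a vector, as a subspace. -/
def orthogonalTo (ψ : n → ℂ) : Submodule ℂ (n → ℂ) where
  carrier := {v | star ψ ⬝ᵥ v = 0}
  add_mem' {a b} ha hb := by
    simp only [Set.mem_ofPred_eq] at *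
    rw [dotProduct_add, ha, hb, add_zero]
  zero_mem' := dotProduct_zero _
  smul_mem' c a ha := by
    simp only [Set.mem_ofPred_eq] at *
    rw [dotProduct_smul, ha, smul_zero]

theorem mem_orthogonalTo {ψ v : n → ℂ} : v ∈ orthogonalTo ψ ↔ star ψ ⬝ᵥ v = 0 := Iff.rfl

theorem star_vecMul_eq (A : Matrix n n ℂ) (ψ : n → ℂ) : star ψ ᵥ* A = star (Aᴴ *ᵥ ψ) := by
  rw [Matrix.star_mulVec, Matrix.conjTranspose_conjTranspose]

theorem star_dotProduct_mulVec_eq (A : Matrix n n ℂ) (ψ v : n → ℂ) :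
    star ψ ⬝ᵥ A *ᵥ v = star (Aᴴ *ᵥ ψ) ⬝ᵥ v := by
  rw [Matrix.dotProduct_mulVec, star_vecMul_eq]

/-- A vector annihilated by all jump operators is determined up to a factor. -/
theorem eq_smul_of_forall_mulVec_eq_zero {c : β → Matrix n n ℂ} {ψ : n → ℂ}
    (hψ : ψ ≠ 0)
    (hgen : ∀ W : Submodule ℂ (n → ℂ), (∀ l, (c l)ᴴ *ᵥ ψ ∈ W) →
      (∀ l, ∀ v ∈ W, (c l)ᴴ *ᵥ v ∈ W) → W ⊔ Submodule.span ℂ {ψ} = ⊤)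
    {φ : n → ℂ} (hφ : ∀ l, c l *ᵥ φ = 0) (hc : ∀ l, c l *ᵥ ψ = 0) : ∃ z : ℂ, φ = z • ψ := by
  -- The projection coefficient, so that χ below is orthogonal to ψ.
  set z : ℂ := (star ψ ⬝ᵥ φ) / (star ψ ⬝ᵥ ψ) with hz
  have hψψ : star ψ ⬝ᵥ ψ ≠ 0 := by rwa [Ne, dotProduct_star_self_eq_zero]
  set χ := φ - z • ψ with hχ
  have hcχ : ∀ l, c l *ᵥ χ = 0 := fun l => by
    rw [hχ, Matrix.mulVec_sub, Matrix.mulVec_smul, hφ, hc, smul_zero, sub_zero]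
  have hmem : ∀ l v, (c l)ᴴ *ᵥ v ∈ orthogonalTo χ := fun l v => by
    rw [mem_orthogonalTo, star_dotProduct_mulVec_eq, Matrix.conjTranspose_conjTranspose, hcχ,
      star_zero, zero_dotProduct]
  have hψχ : ψ ∈ orthogonalTo χ := by
    have h : star ψ ⬝ᵥ χ = 0 := by
      rw [hχ, dotProduct_sub, dotProduct_smul, smul_eq_mul, hz, div_mul_cancel₀ _ hψψ, sub_self]
    rw [mem_orthogonalTo, ← star_star (star χ ⬝ᵥ ψ), ← Matrix.star_dotProduct, h, star_zero]
  have htop := hgen (orthogonalTo χ) (fun l => hmem l ψ) (fun l v _ => hmem l v)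
  rw [sup_eq_left.2 ((Submodule.span_singleton_le_iff_mem _ _).2 hψχ)] at htop
  have h : χ ∈ orthogonalTo χ := htop ▸ Submodule.mem_top
  rw [mem_orthogonalTo, dotProduct_star_self_eq_zero] at h
  exact ⟨z, sub_eq_zero.1 h⟩

variable [Fintype β]

/-- Arranged so that only the gain term, an expectation of ρ in c†v, lacks a factor c v, ρ v or the
adjoint of one of these. For Hermitian ρ it alone survives in the dissipator when v is dark or ρ v =
0. -/
theorem star_dotProduct_liouvillian_mulVec (H : Matrix n n ℂ) (g : β → ℝ)
    (c : β → Matrix n n ℂ) (ρ : Matrix n n ℂ) (v : n → ℂ) :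
    star v ⬝ᵥ liouvillian H g c ρ *ᵥ v =
      -Complex.I * (star v ⬝ᵥ H *ᵥ ρ *ᵥ v - star v ⬝ᵥ ρ *ᵥ H *ᵥ v) +
      ∑ l, (g l : ℂ) * (2 * (star ((c l)ᴴ *ᵥ v) ⬝ᵥ ρ *ᵥ (c l)ᴴ *ᵥ v) -
        star (c l *ᵥ v) ⬝ᵥ c l *ᵥ ρ *ᵥ v - star v ⬝ᵥ ρ *ᵥ (c l)ᴴ *ᵥ c l *ᵥ v) := by
  rw [liouvillian, Matrix.add_mulVec, dotProduct_add, Matrix.sum_mulVec, dotProduct_sum]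
  congr 1
  · rw [Matrix.smul_mulVec, dotProduct_smul, Matrix.sub_mulVec, dotProduct_sub,
      ← Matrix.mulVec_mulVec, ← Matrix.mulVec_mulVec, smul_eq_mul]
  · refine Finset.sum_congr rfl fun l _ => ?_
    rw [Matrix.smul_mulVec, dotProduct_smul, Matrix.sub_mulVec, Matrix.sub_mulVec,
      Matrix.smul_mulVec, dotProduct_sub, dotProduct_sub, dotProduct_smul, smul_eq_mul,
      smul_eq_mul, ← star_dotProduct_mulVec_eq]
    have e := star_dotProduct_mulVec_eq (c l)ᴴ v (c l *ᵥ ρ *ᵥ v)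
    rw [Matrix.conjTranspose_conjTranspose] at e
    rw [← e]
    simp only [Matrix.mulVec_mulVec, Matrix.mul_assoc]

/-- If a sum of nonnegative expectation values with positive weights vanishes, then the state
annihilates each of the vectors. -/
theorem mulVec_eq_zero_of_sum_eq_zero {g : β → ℝ} (hg : ∀ l, 0 < g l) {ρ : Matrix n n ℂ}
    (hρ : ρ.PosSemidef) (v : β → n → ℂ)
    (h : ∑ l, (g l : ℂ) * (2 * (star (v l) ⬝ᵥ ρ *ᵥ v l)) = 0) (l : β) : ρ *ᵥ v l = 0 := by
  have hnn : ∀ l ∈ Finset.univ, 0 ≤ (g l : ℂ) * (2 * (star (v l) ⬝ᵥ ρ *ᵥ v l)) := fun l _ =>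
    mul_nonneg (by exact_mod_cast (hg l).le)
      (mul_nonneg zero_le_two (hρ.dotProduct_mulVec_nonneg _))
  have h1 := (Finset.sum_eq_zero_iff_of_nonneg hnn).1 h l (Finset.mem_univ l)
  have hg0 : (g l : ℂ) ≠ 0 := by exact_mod_cast (hg l).ne'
  rw [mul_eq_zero, mul_eq_zero, or_iff_right hg0, or_iff_right two_ne_zero] at h1
  exact (hρ.dotProduct_mulVec_zero_iff _).1 h1

/-- A normalized common eigenvector of `H` annihilated by all jump operators is the unique
stationary state, if it generates its orthogonal complement under the adjoint jump operators. -/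
theorem isStationaryState_iff {H : Matrix n n ℂ} (hH : H.IsHermitian) {g : β → ℝ}
    (hg : ∀ l, 0 < g l) {c : β → Matrix n n ℂ} {ψ : n → ℂ} (hψ : star ψ ⬝ᵥ ψ = 1)
    (hc : ∀ l, c l *ᵥ ψ = 0) {E : ℝ} (hE : H *ᵥ ψ = (E : ℂ) • ψ)
    (hgen : ∀ W : Submodule ℂ (n → ℂ), (∀ l, (c l)ᴴ *ᵥ ψ ∈ W) →
      (∀ l, ∀ v ∈ W, (c l)ᴴ *ᵥ v ∈ W) → W ⊔ Submodule.span ℂ {ψ} = ⊤)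
    (ρ : Matrix n n ℂ) : IsStationaryState H g c ρ ↔ ρ = ketBra ψ := by
  -- Since E is real, the left and right eigenvalues agree and the commutator drops out.
  have hEl : star ψ ᵥ* H = (E : ℂ) • star ψ := by
    rw [star_vecMul_eq, hH.eq, hE, star_smul]
    simp
  constructor
  · rintro ⟨⟨hρ, htr⟩, hL⟩
    have hdark : ∀ l, ρ *ᵥ (c l)ᴴ *ᵥ ψ = 0 := by
      refine mulVec_eq_zero_of_sum_eq_zero hg hρ (fun l => (c l)ᴴ *ᵥ ψ) ?_
      have h := star_dotProduct_liouvillian_mulVec H g c ρ ψ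
      rw [hL, Matrix.zero_mulVec, dotProduct_zero, Matrix.dotProduct_mulVec _ H, hEl, hE] at h
      simpa [hc, Matrix.mulVec_smul] using h.symm
    have hker : ∀ l v, ρ *ᵥ v = 0 → ρ *ᵥ (c l)ᴴ *ᵥ v = 0 := by
      intro l v hv
      have hv' : ∀ u, star v ⬝ᵥ ρ *ᵥ u = 0 := fun u => by
        rw [star_dotProduct_mulVec_eq, hρ.isHermitian.eq, hv, star_zero, zero_dotProduct]
      refine mulVec_eq_zero_of_sum_eq_zero hg hρ (fun l => (c l)ᴴ *ᵥ v) ?_ l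
      have h := star_dotProduct_liouvillian_mulVec H g c ρ v
      rw [hL, Matrix.zero_mulVec, dotProduct_zero] at h
      simp only [hv, hv', Matrix.mulVec_zero, dotProduct_zero, sub_zero, mul_zero,
        zero_add] at h
      exact h.symm
    -- Orthogonality to ψ costs nothing, as ranges of adjoint jumps are orthogonal to a dark vector;
    -- it makes the decomposition below orthogonal.
    set W : Submodule ℂ (n → ℂ) := LinearMap.ker ρ.mulVecLin ⊓ orthogonalTo ψ with hW
    have hWmem : ∀ v, v ∈ W ↔ ρ *ᵥ v = 0 ∧ star ψ ⬝ᵥ v = 0 := fun v => Iff.rfl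
    have horth : ∀ l v, star ψ ⬝ᵥ (c l)ᴴ *ᵥ v = 0 := fun l v => by
      rw [star_dotProduct_mulVec_eq, Matrix.conjTranspose_conjTranspose, hc, star_zero,
        zero_dotProduct]
    have htop : W ⊔ Submodule.span ℂ {ψ} = ⊤ := hgen W
      (fun l => (hWmem _).2 ⟨hdark l, horth l ψ⟩)
      (fun l v hv => (hWmem _).2 ⟨hker l v ((hWmem v).1 hv).1, horth l v⟩)
    have hdec : ∀ v, ∃ w ∈ W, ∃ z : ℂ, v = w + z • ψ := by
      intro v
      obtain ⟨w, hw, y, hy, rfl⟩ := Submodule.mem_sup.1 (htop ▸ Submodule.mem_top : v ∈ _)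
      obtain ⟨z, rfl⟩ := Submodule.mem_span_singleton.1 hy
      exact ⟨w, hw, z, rfl⟩
    obtain ⟨w, hw, z, hz⟩ := hdec (ρ *ᵥ ψ)
    -- w is orthogonal to ρψ because ρ w = 0, and to ψ because w ∈ W; hence it is orthogonal to
    -- itself.
    have hw0 : w = 0 := by
      obtain ⟨hw1, hw2⟩ := (hWmem w).1 hw
      have h1 : star w ⬝ᵥ ρ *ᵥ ψ = 0 := by
        rw [star_dotProduct_mulVec_eq, hρ.isHermitian.eq, hw1, star_zero, zero_dotProduct]
      have h2 : star w ⬝ᵥ ψ = 0 := by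
        rw [← star_star (star w ⬝ᵥ ψ), ← Matrix.star_dotProduct, hw2, star_zero]
      rw [hz, dotProduct_add, dotProduct_smul, h2, smul_zero, add_zero,
        dotProduct_star_self_eq_zero] at h1
      exact h1
    rw [hw0, zero_add] at hz
    classical
    have hρz : ρ = z • ketBra ψ := by
      refine Matrix.ext_of_mulVec_single fun i => ?_
      obtain ⟨w, hw, a, ha⟩ := hdec (Pi.single i 1)
      obtain ⟨hw1, hw2⟩ := (hWmem w).1 hw
      rw [ha, Matrix.mulVec_add, hw1, zero_add, Matrix.mulVec_smul, hz, Matrix.smul_mulVec,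
        ketBra, Matrix.vecMulVec_mulVec, dotProduct_add, hw2, zero_add, dotProduct_smul, hψ]
      simp [smul_smul, mul_comm]
    have hz1 : z = 1 := by
      rw [hρz, Matrix.trace_smul, ketBra, Matrix.trace_vecMulVec, dotProduct_comm, hψ,
        smul_eq_mul, mul_one] at htr
      exact htr
    rw [hρz, hz1, one_smul]
  · rintro rfl
    refine ⟨⟨Matrix.posSemidef_vecMulVec_self_star ψ, ?_⟩, ?_⟩
    · rw [ketBra, Matrix.trace_vecMulVec, dotProduct_comm, hψ]
    · have h1 : ∀ l, c l * ketBra ψ = 0 := fun l => by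
        rw [ketBra, Matrix.mul_vecMulVec, hc, Matrix.zero_vecMulVec]
      have h2 : ∀ l, ketBra ψ * ((c l)ᴴ * c l) = 0 := fun l => by
        rw [ketBra, ← Matrix.mul_assoc, Matrix.vecMulVec_mul, ← Matrix.star_mulVec, hc,
          star_zero, Matrix.vecMulVec_zero, Matrix.zero_mul]
      have h3 : H * ketBra ψ - ketBra ψ * H = 0 := by
        rw [ketBra, Matrix.mul_vecMulVec, Matrix.vecMulVec_mul, hE, hEl,
          Matrix.smul_vecMulVec, Matrix.vecMulVec_smul, sub_self]
      simp [liouvillian, h1, h2, h3, Matrix.mul_assoc]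

end Stationary


/-! Adjoints of number-conserving operators -/

theorem exists_eq_add_single {ι : Type} [DecidableEq ι] {n : ι → ℕ} {i : ι} (h : n i ≠ 0) :
    ∃ n' : ι → ℕ, n = n' + Pi.single i 1 := by
  refine ⟨n - Pi.single i 1, ?_⟩
  funext x
  by_cases hx : x = i
  · subst hx; simp; omega
  · simp [hx]

theorem create_annihilate_single_of_left {ι : Type} [DecidableEq ι] (i j : ι) {n : ι → ℕ}
    (m : ι → ℕ) (h : n j = 0) :
    create i (annihilate j (Finsupp.single n 1)) m = 0 := by
  simp [annihilate_single, h]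

section Adjoint

variable {ι : Type} [Fintype ι] [DecidableEq ι]

theorem create_annihilate_single_apply (i j : ι) (n m : ι → ℕ) :
    create i (annihilate j (Finsupp.single (n + Pi.single j 1) 1)) (m + Pi.single i 1) =
      if n = m then ((Real.sqrt (n i + 1) : ℝ) : ℂ) * ((Real.sqrt (n j + 1) : ℝ) : ℂ) else 0 := by
  rw [annihilate_single, create_single, add_tsub_cancel_right, Finsupp.single_apply]
  simp

theorem create_annihilate_single_of_right (i j : ι) (n : ι → ℕ) {m : ι → ℕ} (h : m i = 0) :
    create i (annihilate j (Finsupp.single n 1)) m = 0 := by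
  rw [annihilate_single, create_single, Finsupp.single_apply, if_neg]
  rintro rfl
  simp at h

/-- Removing a particle at j from n and one at i from m must leave the same configuration, a
condition symmetric under the exchange; if either site is empty, both sides vanish. -/
theorem create_annihilate_adjoint (i j : ι) (n m : ι → ℕ) :
    create i (annihilate j (Finsupp.single n 1)) m =
      star (create j (annihilate i (Finsupp.single m 1)) n) := by
  by_cases hn : n j = 0
  · rw [create_annihilate_single_of_left i j m hn, create_annihilate_single_of_right j i m hn,
      star_zero]
  by_cases hm : m i = 0
  · rw [create_annihilate_single_of_right i j n hm, create_annihilate_single_of_left j i n hm,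
      star_zero]
  obtain ⟨n, rfl⟩ := exists_eq_add_single hn
  obtain ⟨m, rfl⟩ := exists_eq_add_single hm
  rw [create_annihilate_single_apply, create_annihilate_single_apply]
  by_cases h : n = m
  · subst h
    simp [mul_comm]
  · rw [if_neg h, if_neg (Ne.symm h), star_zero]

theorem sectorMatrix_create_annihilate_conjTranspose (N : ℕ) (i j : ι) :
    (sectorMatrix N (create i ∘ₗ annihilate j))ᴴ = sectorMatrix N (create j ∘ₗ annihilate i) := by
  ext m n
  exact (create_annihilate_adjoint j i n.1 m.1).symm

end Adjoint

/-- `A ↦ sectorMatrix N A` as a linear map. -/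
noncomputable def sectorMatrixLinear (ι : Type) [Fintype ι] (N : ℕ) :
    (Fock ι →ₗ[ℂ] Fock ι) →ₗ[ℂ] Matrix (Occ ι N) (Occ ι N) ℂ where
  toFun := sectorMatrix N
  map_add' _ _ := rfl
  map_smul' _ _ := rfl

theorem sectorMatrixLinear_apply {ι : Type} [Fintype ι] (N : ℕ) (A : Fock ι →ₗ[ℂ] Fock ι) :
    sectorMatrixLinear ι N A = sectorMatrix N A := rfl

theorem sectorMatrix_add {ι : Type} [Fintype ι] (N : ℕ) (A B : Fock ι →ₗ[ℂ] Fock ι) :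
    sectorMatrix N (A + B) = sectorMatrix N A + sectorMatrix N B := rfl

theorem sectorMatrix_sub {ι : Type} [Fintype ι] (N : ℕ) (A B : Fock ι →ₗ[ℂ] Fock ι) :
    sectorMatrix N (A - B) = sectorMatrix N A - sectorMatrix N B := rfl

theorem sectorMatrix_smul_sum {ι β : Type} [Fintype ι] [Fintype β] (N : ℕ) (z : ℂ)
    (A : β → Fock ι →ₗ[ℂ] Fock ι) :
    sectorMatrix N (z • ∑ l, A l) = z • ∑ l, sectorMatrix N (A l) := by
  simp only [← sectorMatrixLinear_apply, map_smul, map_sum]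

/-- `ψ ↦ sectorVec N ψ` as a linear map. -/
noncomputable def sectorVecLinear (ι : Type) [Fintype ι] (N : ℕ) :
    Fock ι →ₗ[ℂ] (Occ ι N → ℂ) where
  toFun := sectorVec N
  map_add' _ _ := rfl
  map_smul' _ _ := rfl

theorem sectorVecLinear_apply {ι : Type} [Fintype ι] (N : ℕ) (ψ : Fock ι) :
    sectorVecLinear ι N ψ = sectorVec N ψ := rfl

theorem pderiv_X_mem_one {ι : Type} (i j : ι) :
    pderiv i (X j) ∈ (1 : Submodule ℂ (MvPolynomial ι ℂ)) := by
  by_cases h : j = i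
  · subst h
    rw [pderiv_X_self]
    exact Submodule.one_le.1 le_rfl
  · rw [pderiv_X_of_ne h]
    exact Submodule.zero_mem _

/-- The normalization of the condensate in terms of `(∑ x_i) ^ N`. -/
noncomputable def becNorm (d M N : ℕ) : ℝ :=
  (Real.sqrt N.factorial)⁻¹ * (Real.sqrt ((M : ℝ) ^ d))⁻¹ ^ N

theorem becNorm_sq (d M N : ℕ) :
    becNorm d M N ^ 2 = ((N.factorial : ℝ) * ((M : ℝ) ^ d) ^ N)⁻¹ := by
  rw [becNorm, mul_pow, ← pow_mul, mul_comm N 2, pow_mul, inv_pow, inv_pow,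
    Real.sq_sqrt (by positivity), Real.sq_sqrt (by positivity), mul_inv, inv_pow]

/-! ### The condensate and the jump operators on the periodic lattice -/

section Lattice

variable {d M : ℕ}

/-- The derivation `∂_i + ∂_j` of a link. -/
noncomputable def linkDerivation (l : Link d M) :
    Derivation ℂ (MvPolynomial (Site d M) ℂ) (MvPolynomial (Site d M) ℂ) :=
  pderiv l.1 + pderiv (Link.target l)

/-- The linear form `x_i - x_j` of a link. -/
noncomputable def linkForm (l : Link d M) : MvPolynomial (Site d M) ℂ :=
  X l.1 - X (Link.target l)

theorem linkDerivation_linkForm_mem_one (l l' : Link d M) :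
    linkDerivation l (linkForm l') ∈ (1 : Submodule ℂ (MvPolynomial (Site d M) ℂ)) := by
  rw [linkDerivation, Derivation.add_apply, linkForm, map_sub, map_sub]
  exact Submodule.add_mem _
    (Submodule.sub_mem _ (pderiv_X_mem_one _ _) (pderiv_X_mem_one _ _))
    (Submodule.sub_mem _ (pderiv_X_mem_one _ _) (pderiv_X_mem_one _ _))

variable [NeZero M]

/-- The adjoint `(a_i† - a_j†) (a_i + a_j)` of the jump operator of a link. -/
noncomputable def jumpAdjoint (l : Link d M) : Fock (Site d M) →ₗ[ℂ] Fock (Site d M) :=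
  (create l.1 - create (Link.target l)) ∘ₗ (annihilate l.1 + annihilate (Link.target l))

/-- The product is expanded into hops a_i†a_j before taking adjoints, because a single creation or
annihilation operator leaves the sector. -/
theorem jumpN_conjTranspose (N : ℕ) (l : Link d M) :
    (jumpN d M N l)ᴴ = sectorMatrix N (jumpAdjoint l) := by
  rw [jumpN, jump, jumpAdjoint]
  simp only [LinearMap.add_comp, LinearMap.comp_add, LinearMap.sub_comp, LinearMap.comp_sub,
    sectorMatrix_add, sectorMatrix_sub, Matrix.conjTranspose_add, Matrix.conjTranspose_sub,
    sectorMatrix_create_annihilate_conjTranspose]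
  abel

theorem hoppingN_isHermitian (N : ℕ) (J : ℝ) : (hoppingN d M N J).IsHermitian := by
  rw [Matrix.IsHermitian, hoppingN, hopping, sectorMatrix_smul_sum, Matrix.conjTranspose_smul,
    Matrix.conjTranspose_sum, star_neg, Complex.star_def, Complex.conj_ofReal]
  refine congrArg _ (Finset.sum_congr rfl fun l _ => ?_)
  rw [sectorMatrix_add, Matrix.conjTranspose_add, sectorMatrix_create_annihilate_conjTranspose,
    sectorMatrix_create_annihilate_conjTranspose, add_comm]

/-- The sum of all variables, which stands for the condensate mode. -/
noncomputable def siteSum (d M : ℕ) [NeZero M] : MvPolynomial (Site d M) ℂ :=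
  ∑ i : Site d M, X i

theorem pderiv_siteSum (i : Site d M) : pderiv i (siteSum d M) = 1 := by
  simp [siteSum, pderiv_X, Pi.single_apply]

theorem pderiv_siteSum_pow (i : Site d M) (N : ℕ) :
    pderiv i (siteSum d M ^ N) = (N : MvPolynomial (Site d M) ℂ) * siteSum d M ^ (N - 1) := by
  rw [pderiv_pow, pderiv_siteSum, mul_one]

theorem isHomogeneous_siteSum_pow (N : ℕ) : (siteSum d M ^ N).IsHomogeneous N := by
  have h : (siteSum d M).IsHomogeneous 1 := IsHomogeneous.sum _ _ _ fun i _ => isHomogeneous_X ℂ i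
  simpa using h.pow N

theorem jumpAdjoint_fockOfPoly (l : Link d M) (p : MvPolynomial (Site d M) ℂ) :
    jumpAdjoint l (fockOfPoly (Site d M) p) =
      fockOfPoly (Site d M) (linkForm l * linkDerivation l p) := by
  rw [jumpAdjoint, LinearMap.comp_apply, LinearMap.add_apply, annihilate_fockOfPoly,
    annihilate_fockOfPoly, ← map_add, LinearMap.sub_apply, create_fockOfPoly, create_fockOfPoly,
    ← map_sub, ← sub_mul]
  rfl

theorem linkDerivation_siteSum (l : Link d M) : linkDerivation l (siteSum d M) = 2 := by
  rw [linkDerivation, Derivation.add_apply, pderiv_siteSum, pderiv_siteSum, one_add_one_eq_two]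

/-- The lattice is connected: all differences of variables are combinations of link forms. -/
theorem X_sub_X_add_mem (v i : Site d M) :
    (X i - X (i + v) : MvPolynomial (Site d M) ℂ) ∈
      Submodule.span ℂ (Set.range (linkForm (d := d) (M := M))) := by
  set Y := Submodule.span ℂ (Set.range (linkForm (d := d) (M := M))) with hY
  -- Quantifying over all base points makes the admissible shifts closed under addition, by
  -- telescoping; unit steps then generate every shift.
  let S : AddSubmonoid (Site d M) :=
    { carrier := {v | ∀ i : Site d M, (X i - X (i + v) : MvPolynomial (Site d M) ℂ) ∈ Y}
      zero_mem' := fun i => by simp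
      add_mem' := fun {a b} ha hb i => by
        have h := Y.add_mem (ha i) (hb (i + a))
        rwa [sub_add_sub_cancel, add_assoc] at h }
  have h1 : ∀ μ : Fin d, (Pi.single μ 1 : Site d M) ∈ S := fun μ i =>
    Submodule.subset_span ⟨(i, μ), rfl⟩
  have h2 : ∀ (μ : Fin d) (a : ZMod M), (Pi.single μ a : Site d M) ∈ S := fun μ a => by
    have h := S.nsmul_mem (h1 μ) a.val
    rwa [← Pi.single_smul, nsmul_eq_mul, ZMod.natCast_zmod_val, mul_one] at h
  have h3 : v ∈ S := by
    rw [← Finset.univ_sum_single v]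
    exact S.sum_mem fun μ _ => h2 μ _
  exact h3 i

/-- Averaging: |Λ| x_i is s plus the sum of the differences x_i - x_j over all sites j. -/
theorem X_mem_sup (i : Site d M) : (X i : MvPolynomial (Site d M) ℂ) ∈
    Submodule.span ℂ {siteSum d M} ⊔
      Submodule.span ℂ (Set.range (linkForm (d := d) (M := M))) := by
  have hc : (Fintype.card (Site d M) : ℂ) ≠ 0 := Nat.cast_ne_zero.2 Fintype.card_ne_zero
  refine (Submodule.smul_mem_iff _ hc).1 ?_
  have e : (Fintype.card (Site d M) : ℂ) • (X i : MvPolynomial (Site d M) ℂ) =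
      siteSum d M + ∑ j : Site d M, (X i - X (i + (j - i))) := by
    rw [Nat.cast_smul_eq_nsmul, siteSum]
    simp [Finset.sum_sub_distrib]
  rw [e]
  exact Submodule.add_mem_sup (Submodule.mem_span_singleton_self _)
    (Submodule.sum_mem _ fun j _ => X_sub_X_add_mem _ _)

theorem homogeneousSubmodule_le_sup_pow (N : ℕ) : homogeneousSubmodule (Site d M) ℂ N ≤
    (Submodule.span ℂ {siteSum d M} ⊔
      Submodule.span ℂ (Set.range (linkForm (d := d) (M := M)))) ^ N := by
  rw [← homogeneousSubmodule_one_pow, homogeneousSubmodule_one_eq_span_X]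
  refine pow_le_pow_left' ?_ N
  rw [Submodule.span_le]
  rintro _ ⟨i, rfl⟩
  exact X_mem_sup i

theorem becNorm_ne_zero (N : ℕ) : becNorm d M N ≠ 0 := by
  have hM : (0 : ℝ) < M := Nat.cast_pos.2 (NeZero.pos M)
  rw [becNorm]
  positivity

theorem createMomentum_zero_pow_vacuum (N : ℕ) :
    (createMomentum (0 : Site d M) ^ N) (vacuum (Site d M)) =
      ((Real.sqrt ((M : ℝ) ^ d) : ℝ) : ℂ)⁻¹ ^ N • fockOfPoly (Site d M) (siteSum d M ^ N) := by
  induction N with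
  | zero =>
    rw [pow_zero, pow_zero, pow_zero, one_smul, Module.End.one_apply, ← C_1, C_apply,
      fockOfPoly_monomial]
    simp [vacuum]
  | succ N ih =>
    rw [pow_succ', Module.End.mul_apply, ih, map_smul, createMomentum]
    simp only [Pi.zero_apply, zero_mul, Finset.sum_const_zero, neg_zero, AddChar.map_zero_eq_one,
      one_smul, LinearMap.smul_apply, LinearMap.sum_apply, create_fockOfPoly]
    rw [← map_sum, ← Finset.sum_mul, smul_smul, ← pow_succ, pow_succ' (siteSum d M)]
    rfl

theorem becN_eq (N : ℕ) : becN d M N =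
    (becNorm d M N : ℂ) • sectorVec N (fockOfPoly (Site d M) (siteSum d M ^ N)) := by
  rw [becN, bec, createMomentum_zero_pow_vacuum, smul_smul, ← sectorVecLinear_apply, map_smul,
    sectorVecLinear_apply, becNorm]
  push_cast
  rfl

theorem becN_generates (N : ℕ) (W : Submodule ℂ (Occ (Site d M) N → ℂ))
    (h0 : ∀ l, (jumpN d M N l)ᴴ *ᵥ becN d M N ∈ W)
    (hW : ∀ l, ∀ v ∈ W, (jumpN d M N l)ᴴ *ᵥ v ∈ W) :
    W ⊔ Submodule.span ℂ {becN d M N} = ⊤ := by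
  set F := sectorVecLinear (Site d M) N ∘ₗ fockOfPoly (Site d M) with hF
  have hFa : ∀ p, F p = sectorVec N (fockOfPoly (Site d M) p) := fun _ => rfl
  have hc0 : (becNorm d M N : ℂ) ≠ 0 := Complex.ofReal_ne_zero.2 (becNorm_ne_zero N)
  have hbec : becN d M N = (becNorm d M N : ℂ) • F (siteSum d M ^ N) := becN_eq N
  have hmem : ∀ (l : Link d M) (ψ : Fock (Site d M)), ψ ∈ sector (Site d M) N →
      jumpAdjoint l ψ ∈ sector (Site d M) N := by
    intro l ψ h
    have e : jumpAdjoint l ψ =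
        (create l.1 (annihilate l.1 ψ) + create l.1 (annihilate (Link.target l) ψ)) -
          (create (Link.target l) (annihilate l.1 ψ) +
            create (Link.target l) (annihilate (Link.target l) ψ)) := by
      rw [jumpAdjoint, LinearMap.comp_apply, LinearMap.sub_apply, LinearMap.add_apply, map_add,
        map_add]
    rw [e]
    exact Submodule.sub_mem _
      (Submodule.add_mem _ (create_annihilate_mem _ _ h) (create_annihilate_mem _ _ h))
      (Submodule.add_mem _ (create_annihilate_mem _ _ h) (create_annihilate_mem _ _ h))
  have hsec : fockOfPoly (Site d M) (siteSum d M ^ N) ∈ sector (Site d M) N :=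
    fockOfPoly_mem_sector (isHomogeneous_siteSum_pow N)
  have hact : ∀ (l : Link d M) (p : MvPolynomial (Site d M) ℂ),
      fockOfPoly (Site d M) p ∈ sector (Site d M) N →
      (jumpN d M N l)ᴴ *ᵥ F p = F (linkForm l * linkDerivation l p) := by
    intro l p hp
    rw [jumpN_conjTranspose, hFa, sectorMatrix_mulVec N _ hp, jumpAdjoint_fockOfPoly, hFa]
  have hle := pow_le_sup_of_invariant (linkDerivation (d := d) (M := M)) linkForm (siteSum d M)
    linkDerivation_siteSum linkDerivation_linkForm_mem_one N
    -- The sector condition is carried along because `sectorMatrix` represents the operator only on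
    -- N-particle vectors.
    ((sector (Site d M) N).comap (fockOfPoly (Site d M)) ⊓ W.comap F)
    (fun l => ⟨by
        rw [SetLike.mem_coe, Submodule.mem_comap, ← jumpAdjoint_fockOfPoly]
        exact hmem l _ hsec, by
        have h := h0 l
        rw [hbec, Matrix.mulVec_smul, hact l _ hsec, Submodule.smul_mem_iff _ hc0] at h
        exact h⟩)
    (fun l f hf => ⟨by
        rw [SetLike.mem_coe, Submodule.mem_comap, ← jumpAdjoint_fockOfPoly]
        exact hmem l _ hf.1, by
        have h := hW l _ hf.2
        rw [hact l _ hf.1] at h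
        exact h⟩)
  refine eq_top_of_forall_isHomogeneous _ fun p hp => ?_
  obtain ⟨f, hf, g, hg, rfl⟩ := Submodule.mem_sup.1
    (hle (homogeneousSubmodule_le_sup_pow N ((mem_homogeneousSubmodule N p).2 hp)))
  obtain ⟨z, rfl⟩ := Submodule.mem_span_singleton.1 hg
  rw [← hFa, map_add, map_smul]
  refine Submodule.add_mem_sup hf.2 (Submodule.smul_mem _ _ ?_)
  refine (Submodule.smul_mem_iff _ hc0).1 ?_
  rw [← hbec]
  exact Submodule.mem_span_singleton_self _

/-- All partial derivatives of s^N coincide, so a_i - a_j already kills the condensate. -/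
theorem jumpN_mulVec_becN (N : ℕ) (l : Link d M) : jumpN d M N l *ᵥ becN d M N = 0 := by
  rw [becN_eq, Matrix.mulVec_smul, jumpN,
    sectorMatrix_mulVec N _ (fockOfPoly_mem_sector (isHomogeneous_siteSum_pow N)), jump,
    LinearMap.comp_apply, LinearMap.sub_apply, annihilate_fockOfPoly, annihilate_fockOfPoly,
    pderiv_siteSum_pow, pderiv_siteSum_pow, sub_self, map_zero]
  exact smul_zero _

/-- In each direction every site is the start of one link and, by periodicity, the target of one. -/
theorem sum_X_link_target : ∑ l : Link d M, (X l.1 + X (Link.target l)) =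
    (2 * d : MvPolynomial (Site d M) ℂ) * siteSum d M := by
  have h : ∀ μ : Fin d, ∑ i : Site d M, (X (i + Pi.single μ 1) : MvPolynomial (Site d M) ℂ) =
      siteSum d M := fun μ =>
    Fintype.sum_equiv (Equiv.addRight (Pi.single μ 1)) _ _ fun _ => rfl
  rw [Fintype.sum_prod_type_right]
  have h0 : ∑ i : Site d M, (X i : MvPolynomial (Site d M) ℂ) = siteSum d M := rfl
  simp only [Link.target, Finset.sum_add_distrib, h, h0, Finset.sum_const, Finset.card_univ, Fintype.card_fin, nsmul_eq_mul]
  ring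

theorem hoppingN_mulVec_becN (N : ℕ) (J : ℝ) :
    hoppingN d M N J *ᵥ becN d M N = ((-J * (2 * d * N) : ℝ) : ℂ) • becN d M N := by
  have key : (∑ l : Link d M, (create l.1 ∘ₗ annihilate (Link.target l) +
      create (Link.target l) ∘ₗ annihilate l.1)) (fockOfPoly (Site d M) (siteSum d M ^ N)) =
      (2 * d * N : ℂ) • fockOfPoly (Site d M) (siteSum d M ^ N) := by
    simp only [LinearMap.sum_apply, LinearMap.add_apply, LinearMap.comp_apply,
      annihilate_fockOfPoly, create_fockOfPoly, pderiv_siteSum_pow, ← map_add, ← add_mul,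
      ← map_sum, ← Finset.sum_mul]
    rw [sum_X_link_target, ← map_smul]
    congr 1
    rw [Algebra.smul_def]
    simp only [map_mul, map_natCast, map_ofNat]
    -- The exponent N - 1 truncates at N = 0, where the prefactor N vanishes.
    cases N with
    | zero => simp
    | succ N => rw [Nat.add_sub_cancel, pow_succ]; ring
  rw [becN_eq, Matrix.mulVec_smul, hoppingN,
    sectorMatrix_mulVec N _ (fockOfPoly_mem_sector (isHomogeneous_siteSum_pow N)), hopping,
    LinearMap.smul_apply, key, ← sectorVecLinear_apply, map_smul, map_smul,
    sectorVecLinear_apply, smul_smul, smul_smul, smul_smul]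
  congr 1
  push_cast
  ring

theorem becN_apply (N : ℕ) (n : Occ (Site d M) N) : becN d M N n =
    ((becNorm d M N * (Nat.multinomial Finset.univ n.1 *
      Real.sqrt ((∏ i, (n.1 i).factorial : ℕ) : ℝ)) : ℝ) : ℂ) := by
  set k : Site d M →₀ ℕ := Finsupp.equivFunOnFinite.symm n.1 with hk
  have hkn : (k : Site d M → ℕ) = n.1 := by simp [hk]
  have hsum : (k.sum fun _ m => m) = N := by
    rw [Finsupp.sum_fintype _ _ fun _ => rfl, hkn, n.2]
  have hcoeff : coeff k (siteSum d M ^ N) = (Nat.multinomial Finset.univ n.1 : ℂ) := by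
    rw [siteSum, coeff_sum_X_pow_of_fintype, if_pos hsum,
      ← Finsupp.multinomial_of_support_subset (Finset.subset_univ k.support), hkn]
  rw [becN_eq, Pi.smul_apply, sectorVec, ← hkn, fockOfPoly_apply, hcoeff, hkn]
  push_cast
  rfl

/-- The occupation probabilities are multinomial coefficients divided by M^(dN), and the multinomial
theorem at all ones sums them to 1. -/
theorem star_becN_dotProduct_becN (N : ℕ) : star (becN d M N) ⬝ᵥ becN d M N = 1 := by
  have hM : (0 : ℝ) < M := Nat.cast_pos.2 (NeZero.pos M)
  have h1 : ∀ n : Occ (Site d M) N, star (becN d M N n) * becN d M N n =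
      ((becNorm d M N ^ 2 * N.factorial * Nat.multinomial Finset.univ n.1 : ℝ) : ℂ) := by
    intro n
    have hspec : ((∏ i, (n.1 i).factorial : ℕ) : ℝ) * Nat.multinomial Finset.univ n.1 =
        N.factorial := by
      have h := Nat.multinomial_spec Finset.univ n.1
      rw [n.2] at h
      exact_mod_cast h
    have hs := Real.mul_self_sqrt (Nat.cast_nonneg (α := ℝ) (∏ i, (n.1 i).factorial))
    rw [becN_apply, Complex.star_def, Complex.conj_ofReal, ← Complex.ofReal_mul, ← hspec]
    congr 1
    linear_combination (becNorm d M N ^ 2 * (Nat.multinomial Finset.univ n.1 : ℝ) ^ 2) * hs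
  have h2 : ∑ n : Occ (Site d M) N, (Nat.multinomial Finset.univ n.1 : ℝ) =
      ((M : ℝ) ^ d) ^ N := by
    have h := Finset.sum_pow_eq_sum_piAntidiag (Finset.univ : Finset (Site d M))
      (fun _ => (1 : ℝ)) N
    simp only [one_pow, Finset.prod_const_one, mul_one, Finset.sum_const, Finset.card_univ,
      nsmul_eq_mul, Fintype.card_pi, ZMod.card, Finset.prod_const, Fintype.card_fin,
      Nat.cast_pow] at h
    rw [h]
    exact (Finset.sum_subtype (p := fun n : Site d M → ℕ => ∑ i, n i = N)
      (Finset.piAntidiag Finset.univ N) (fun n => by simp)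
      (fun n => (Nat.multinomial Finset.univ n : ℝ))).symm
  simp only [dotProduct, Pi.star_apply, h1]
  rw [← Complex.ofReal_sum, ← Finset.mul_sum, h2, becNorm_sq, ← Complex.ofReal_one]
  congr 1
  rw [mul_assoc, inv_mul_cancel₀ (by positivity)]

theorem becN_ne_zero (N : ℕ) : becN d M N ≠ 0 := by
  intro h
  have := star_becN_dotProduct_becN (d := d) (M := M) N
  rw [h, dotProduct_zero] at this
  exact zero_ne_one this

theorem forall_jumpN_mulVec_eq_zero_iff (N : ℕ) (ψ : Occ (Site d M) N → ℂ) :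
    (∀ l : Link d M, jumpN d M N l *ᵥ ψ = 0) ↔ ∃ z : ℂ, ψ = z • becN d M N := by
  constructor
  · intro h
    exact eq_smul_of_forall_mulVec_eq_zero (becN_ne_zero N) (becN_generates N) h
      (jumpN_mulVec_becN N)
  · rintro ⟨z, rfl⟩ l
    rw [Matrix.mulVec_smul, jumpN_mulVec_becN, smul_zero]

end Lattice

end DrivenBEC

theorem mainTheorem7 (d M N : ℕ) [NeZero M] (J g : ℝ) (hg : 0 < g) :
    (∀ ψ : Occ (Site d M) N → ℂ,
      (∀ l : Link d M, jumpN d M N l *ᵥ ψ = 0) ↔ ∃ z : ℂ, ψ = z • becN d M N) ∧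
    (∀ ψ : Occ (Site d M) N → ℂ,
      IsDarkState (hoppingN d M N J) (jumpN d M N) ψ ↔
        ∃ z : ℂ, z ≠ 0 ∧ ψ = z • becN d M N) ∧
    (∀ ρ : Matrix (Occ (Site d M) N) (Occ (Site d M) N) ℂ,
      IsStationaryState (hoppingN d M N J) (fun _ => g) (jumpN d M N) ρ ↔
        ρ = ketBra (becN d M N)) := by
  refine ⟨forall_jumpN_mulVec_eq_zero_iff N, fun ψ => ⟨?_, ?_⟩, fun ρ => ?_⟩
  · rintro ⟨hψ, hc, -⟩
    obtain ⟨z, rfl⟩ := (forall_jumpN_mulVec_eq_zero_iff N ψ).1 hc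
    exact ⟨z, fun h => hψ (by rw [h, zero_smul]), rfl⟩
  · rintro ⟨z, hz, rfl⟩
    refine ⟨smul_ne_zero hz (becN_ne_zero N),
      (forall_jumpN_mulVec_eq_zero_iff N _).2 ⟨z, rfl⟩,
      ((-J * (2 * d * N) : ℝ) : ℂ), ?_⟩
    rw [Matrix.mulVec_smul, hoppingN_mulVec_becN, smul_comm]
  · exact isStationaryState_iff (hoppingN_isHermitian N J) (fun _ => hg)
      (star_becN_dotProduct_becN N) (jumpN_mulVec_becN N) (hoppingN_mulVec_becN N J)
      (becN_generates N) ρ
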